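/- **Theorem (Simultaneous Amplitude Estimation).** There is an absolute constant $C>0$ such that the following holds. Let $n,k\ge 0$, let $O$ be a one-qubit unitary (the oracle), let $U_{i,y}$ ($0\le i\le k$, $0\le y<2^n$) be one-qubit unitaries that do not depend on $O$, put $A_y=U_{k,y}\,O\,U_{k-1,y}\cdots U_{1,y}\,O\,U_{0,y}$ and $$|\xi_y\rangle=A_y|0\rangle=\beta_{0y}|0\rangle+\beta_{1y}|1\rangle .$$ Let $A_{\mathrm{initial}}$ be an $n$-qubit unitary with $A_{\mathrm{initial}}|0^n\rangle=\sum_y\alpha_y|y\rangle$, and let $0<\epsilon\le 1$ and $0<\delta<1$. Put $m=\lceil\log_2(1/\epsilon)\rceil+3+s$, where $s=0$ if $\delta\ge 1-8/\pi^2$ and $s=\lceil\log_2(1/\delta)\rceil$ otherwise. The circuit SimulAE-Algo works on registers $R_1$ ($n$ qubits), $R_2$ (one qubit) and $R_3$ ($m$ qubits), all starting in $|0\rangle$. It applies $A_{\mathrm{initial}}$ to $R_1$; then $A=\sum_y|y\rangle\langle y|\otimes A_y$ to $R_1R_2$; then the quantum Fourier transform $F_m$ to $R_3$; then, for each $i=0,\dots,m-1$,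 controlled on qubit $i$ of $R_3$ (the one of weight $2^i$), $2^i$ times the operator $\sum_y|y\rangle\langle y|\otimes G_y$, where $G_y=-A_yS_0A_y^\dagger S_\chi$ and $S_0=S_\chi=I-2|0\rangle\langle 0|$; finally $F_m^{-1}$ to $R_3$. Here $A$ and $A^\dagger$ are run gate by gate: each $U_{i,y}$ is applied to $R_2$ conditioned on $R_1=|y\rangle$, one $y$ after the other, and each occurrence of $O$ (or $O^\dagger$) is one (controlled) application to $R_2$ that does not look at $R_1$ and counts as one query. Let $\mathrm{AmpEst}_y=(I\otimes F_m^{-1})\big(\sum_x G_y^x\otimes|x\rangle\langle x|\big)(I\otimes F_m)$ on $R_2R_3$. For an index $y$, call $j\in\{0,\dots,2^m-1\}$ *good for $y$* if $\sin^2(j\pi/2^m)$ is an $\epsilon$-estimate of the probability $|\beta_{0y}|^2$ of $|0\rangle$ in $|\xi_y\rangle$, that is, $\big|\sin^2(j\pi/2^m)-|\beta_{0y}|^2\big|\le\epsilon$. Then: 1. SimulAE-Algo makes at most $C\,\dfrac{k}{\epsilon\,\delta}$ queries to $O$; so for a fixed error $\delta$ it makes $O(k/\epsilon)$ queries, independently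 of the number $N=2^n$ of indices. 2. Its output is $\displaystyle|\Phi\rangle=\sum_y\alpha_y|y\rangle|\Phi_y\rangle$ with $|\Phi_y\rangle=\mathrm{AmpEst}_y\big(|\xi_y\rangle|0^m\rangle\big)$. 3. For every $y$ there are orthogonal (possibly zero) vectors $|\psi_y^0\rangle,|\psi_y^1\rangle$ of $R_2$ and unit vectors $|e_y^0\rangle,|e_y^1\rangle$ of $R_3$ such that $|\xi_y\rangle=|\psi_y^0\rangle+|\psi_y^1\rangle$ and $|\Phi_y\rangle=|\psi_y^0\rangle|e_y^0\rangle+|\psi_y^1\rangle|e_y^1\rangle$, and measuring either $|e_y^s\rangle$ in the standard basis gives a $j$ that is good for $y$ with probability at least $1-\delta$. 4. For every $y$, measuring $R_3$ in $|\Phi_y\rangle$ in the standard basis gives a $j$ that is good for $y$ with probability at least $1-\delta$; and measuring $R_1R_3$ in $|\Phi\rangle$ gives, with probability at least $1-\delta$, a pair $(y,j)$ such that $j$ is good for $y$. -/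

import Mathlib

open scoped Kronecker Matrix

namespace SimulAE

/-- Basis labels of the three registers: `R₁` (`n` qubits, the index `y`), `R₂` (one qubit),
`R₃` (`m` qubits, the estimate, read as a number below `2 ^ m`). -/
abbrev Reg (n m : ℕ) : Type := Fin (2 ^ n) × Fin 2 × Fin (2 ^ m)

/-- The operator that acts on `R₂` by `W y j` when `R₁` is in `|y⟩` and `R₃` is
in `|j⟩`, i.e. `∑ y j, |y⟩⟨y| ⊗ W y j ⊗ |j⟩⟨j|`. -/
def blockOp {n m : ℕ} (W : Fin (2 ^ n) → Fin (2 ^ m) → Matrix (Fin 2) (Fin 2) ℂ) :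
    Matrix (Reg n m) (Reg n m) ℂ :=
  Matrix.of fun p q => if p.1 = q.1 ∧ p.2.2 = q.2.2 then W p.1 p.2.2 p.2.1 q.2.1 else 0

/-- The quantum Fourier transform on `m` qubits,
`|l⟩ ↦ 2^(-m/2) ∑ j, exp (2 π i j l / 2^m) |j⟩`. -/
noncomputable def qft (m : ℕ) : Matrix (Fin (2 ^ m)) (Fin (2 ^ m)) ℂ :=
  Matrix.of fun j l =>
    Complex.exp (2 * Real.pi * Complex.I * (j.val : ℂ) * (l.val : ℂ) / (2 ^ m : ℂ)) /
      (Real.sqrt (2 ^ m) : ℂ)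

/-- The reflection `I - 2|0⟩⟨0|` of one qubit. -/
def flipZero : Matrix (Fin 2) (Fin 2) ℂ := Matrix.diagonal ![-1, 1]

/-- Gates of an oracle circuit. The oracle is not part of the circuit: it enters only through the
gates `query`. A control `c` is either absent or one of the qubits of `R₃`. -/
inductive Gate (n m : ℕ) : Type
  /-- `V` applied to `R₁` -/
  | onIndex (V : Matrix.unitaryGroup (Fin (2 ^ n)) ℂ) : Gate n m
  /-- `W` applied to `R₂` if `R₁` is in `|y⟩` and the control is in `|1⟩` -/
  | onTarget (c : Option (Fin m)) (y : Fin (2 ^ n)) (W : Matrix.unitaryGroup (Fin 2) ℂ) : Gate n m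
  /-- `I - 2|0⟩⟨0|` applied to `R₂` if the control is in `|1⟩` -/
  | flip (c : Option (Fin m)) : Gate n m
  /-- the phase `-1` if the control is in `|1⟩` -/
  | neg (c : Option (Fin m)) : Gate n m
  /-- the quantum Fourier transform on `R₃`, or its inverse if `inv` -/
  | fourier (inv : Bool) : Gate n m
  /-- one oracle query: `O`, or `O†` if `inv`, applied to `R₂` if the control is in `|1⟩` -/
  | query (c : Option (Fin m)) (inv : Bool) : Gate n m

namespace Gate

/-- Is the control satisfied when `R₃` is in the basis state `|j⟩`? -/
def active {m : ℕ} (c : Option (Fin m)) (j : Fin (2 ^ m)) : Bool :=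
  match c with
  | none => true
  | some i => j.val.testBit i.val

/-- The operator of a gate, once the oracle `O` is plugged in. -/
noncomputable def op {n m : ℕ} (O : Matrix.unitaryGroup (Fin 2) ℂ) :
    Gate n m → Matrix (Reg n m) (Reg n m) ℂ
  | onIndex V => (V : Matrix (Fin (2 ^ n)) (Fin (2 ^ n)) ℂ) ⊗ₖ
      (1 : Matrix (Fin 2 × Fin (2 ^ m)) (Fin 2 × Fin (2 ^ m)) ℂ)
  | onTarget c y W => blockOp fun y' j =>
      if y' = y ∧ active c j = true then (W : Matrix (Fin 2) (Fin 2) ℂ) else 1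
  | flip c => blockOp fun _ j => if active c j then flipZero else 1
  | neg c => blockOp fun _ j => if active c j then -1 else 1
  | fourier inv => (1 : Matrix (Fin (2 ^ n)) (Fin (2 ^ n)) ℂ) ⊗ₖ
      ((1 : Matrix (Fin 2) (Fin 2) ℂ) ⊗ₖ (if inv then (qft m)ᴴ else qft m))
  | query c inv => blockOp fun _ j =>
      if active c j then
        (if inv then (O : Matrix (Fin 2) (Fin 2) ℂ)ᴴ else (O : Matrix (Fin 2) (Fin 2) ℂ))
      else 1

/-- The inverse gate. -/
noncomputable def inverse {n m : ℕ} : Gate n m → Gate n m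
  | onIndex V => onIndex V⁻¹
  | onTarget c y W => onTarget c y W⁻¹
  | flip c => flip c
  | neg c => neg c
  | fourier inv => fourier (!inv)
  | query c inv => query c (!inv)

/-- The number of oracle queries of a gate. -/
def cost {n m : ℕ} : Gate n m → ℕ
  | query _ _ => 1
  | _ => 0

end Gate

/-- A circuit is the list of its gates, in the order of application. -/
abbrev Circuit (n m : ℕ) : Type := List (Gate n m)

namespace Circuit

/-- The number of oracle queries of a circuit. -/
def queries {n m : ℕ} (L : Circuit n m) : ℕ := (L.map Gate.cost).sum

/-- The state obtained from `ψ` by running a circuit with oracle `O`. -/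
noncomputable def run {n m : ℕ} (O : Matrix.unitaryGroup (Fin 2) ℂ) (L : Circuit n m)
    (ψ : Reg n m → ℂ) : Reg n m → ℂ :=
  L.foldl (fun φ g => (g.op O).mulVec φ) ψ

/-- The inverse circuit. -/
noncomputable def inverse {n m : ℕ} (L : Circuit n m) : Circuit n m :=
  (L.map Gate.inverse).reverse

end Circuit

/-- For each `y` in turn, `W y` applied to `R₂` conditioned on `R₁` being in `|y⟩`. -/
def layer {n m : ℕ} (c : Option (Fin m)) (W : Fin (2 ^ n) → Matrix.unitaryGroup (Fin 2) ℂ) :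
    Circuit n m :=
  (List.finRange (2 ^ n)).map fun y => Gate.onTarget c y (W y)

/-- The (controlled) circuit of `A = ∑ y, |y⟩⟨y| ⊗ A_y` with
`A_y = U k y * O * U (k-1) y * ⋯ * U 1 y * O * U 0 y`; only `U 0, …, U k` are used. -/
def prepare {n m : ℕ} (c : Option (Fin m))
    (U : ℕ → Fin (2 ^ n) → Matrix.unitaryGroup (Fin 2) ℂ) : ℕ → Circuit n m
  | 0 => layer c (U 0)
  | k + 1 => prepare c U k ++ [Gate.query c false] ++ layer c (U (k + 1))

/-- The (controlled) circuit of `∑ y, |y⟩⟨y| ⊗ G_y`, `G_y = - A_y S₀ A_y† S_χ`. -/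
noncomputable def groverStep {n m : ℕ} (c : Option (Fin m))
    (U : ℕ → Fin (2 ^ n) → Matrix.unitaryGroup (Fin 2) ℂ) (k : ℕ) : Circuit n m :=
  [Gate.flip c] ++ Circuit.inverse (prepare c U k) ++ [Gate.flip c] ++ prepare c U k ++
    [Gate.neg c]

/-- The algorithm with `m` estimate qubits: apply `A_initial` and `A`; then the Fourier transform
on `R₃`; for each qubit `i` of `R₃` the Grover step `2 ^ i` times, controlled on that qubit; then
the inverse Fourier transform. -/
noncomputable def simulAE {n : ℕ} (m : ℕ) (V : Matrix.unitaryGroup (Fin (2 ^ n)) ℂ)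
    (U : ℕ → Fin (2 ^ n) → Matrix.unitaryGroup (Fin 2) ℂ) (k : ℕ) : Circuit n m :=
  [Gate.onIndex V] ++ prepare none U k ++ [Gate.fourier false] ++
    (List.finRange m).flatMap
      (fun i => (List.replicate (2 ^ i.val) (groverStep (some i) U k)).flatten) ++
    [Gate.fourier true]

/-- The number `m` of estimate qubits for accuracy `ε` and error `δ`: `⌈log₂ (1/ε)⌉ + 3`, and
`⌈log₂ (1/δ)⌉` more if `δ` is below `1 - 8/π²`. -/
noncomputable def estimateQubits (ε δ : ℝ) : ℕ :=
  ⌈Real.logb 2 (1 / ε)⌉₊ + 3 +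
    (if 1 - 8 / Real.pi ^ 2 ≤ δ then 0 else ⌈Real.logb 2 (1 / δ)⌉₊)

/-- The algorithm `A_y = U k y * O * U (k-1) y * ⋯ * U 1 y * O * U 0 y` as an operator. -/
noncomputable def algo {n : ℕ} (O : Matrix.unitaryGroup (Fin 2) ℂ)
    (U : ℕ → Fin (2 ^ n) → Matrix.unitaryGroup (Fin 2) ℂ) (y : Fin (2 ^ n)) :
    ℕ → Matrix.unitaryGroup (Fin 2) ℂ
  | 0 => U 0 y
  | k + 1 => U (k + 1) y * O * algo O U y k

/-- The state `A|0⟩`, i.e. `b ↦ β_b`. -/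
def prepared {d : ℕ} [NeZero d] (A : Matrix.unitaryGroup (Fin d) ℂ) (b : Fin d) : ℂ :=
  (A : Matrix (Fin d) (Fin d) ℂ).mulVec (Pi.single 0 1) b

/-- The Grover operator `G = - A S₀ A† S_χ`, where `|0⟩` is the good state. -/
noncomputable def grover (A : Matrix.unitaryGroup (Fin 2) ℂ) : Matrix (Fin 2) (Fin 2) ℂ :=
  -((A : Matrix (Fin 2) (Fin 2) ℂ) * flipZero * (A : Matrix (Fin 2) (Fin 2) ℂ)ᴴ * flipZero)

/-- `AmpEst = (I ⊗ F⁻¹) Λ(G) (I ⊗ F)` on `R₂ R₃`, where `Λ(G) = ∑ x, G ^ x ⊗ |x⟩⟨x|`. -/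
noncomputable def ampEst (m : ℕ) (A : Matrix.unitaryGroup (Fin 2) ℂ) :
    Matrix (Fin 2 × Fin (2 ^ m)) (Fin 2 × Fin (2 ^ m)) ℂ :=
  ((1 : Matrix (Fin 2) (Fin 2) ℂ) ⊗ₖ (qft m)ᴴ) *
    (Matrix.of fun p q => if p.2 = q.2 then (grover A ^ p.2.val) p.1 q.1 else 0) *
    ((1 : Matrix (Fin 2) (Fin 2) ℂ) ⊗ₖ qft m)

/-- `AmpEst (A|0⟩ ⊗ |0^m⟩)` -/
noncomputable def estimated (m : ℕ) (A : Matrix.unitaryGroup (Fin 2) ℂ) :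
    Fin 2 × Fin (2 ^ m) → ℂ :=
  (ampEst m A).mulVec fun p => prepared A p.1 * (Pi.single 0 1 : Fin (2 ^ m) → ℂ) p.2

/-- The outcomes `j` of `R₃` for which `sin² (j π / 2^m)` is an `ε`-estimate of `p`. -/
noncomputable def goodOutcomes (m : ℕ) (p ε : ℝ) : Finset (Fin (2 ^ m)) :=
  Finset.univ.filter fun j => |Real.sin (j.val * Real.pi / 2 ^ m) ^ 2 - p| ≤ ε

end SimulAE

/-! After `A_initial` the register `R₁` serves only as a control, so the circuit acts block by
block: for each index it runs ordinary amplitude estimation for `A_y`, weighted by `α_y`. Oracle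
gates do not look at `R₁`, so one query serves all indices at once and `2^n` never enters the count.

For a single index, `G = -A S₀ A† S_χ` is minus the product of two reflections of a plane, so it is
unitary with determinant 1 and trace `2 cos 2θ`, where `sin θ = |β₀|`. Hence `A|0⟩` splits into
orthogonal eigenvectors with eigenvalues `exp (±2iθ)` (`exists_orthogonal_eigenvectors`), and phase
estimation attaches to each the register state `phaseState` at `±θ` (`estimated_decomposition`).
Both signs give the same `sin²`.

For the error, put `M = 2^m`. The weight of `j` at phase `φ` is at most `1 / (M² sin² u)` with `u =
πj/M - φ`, by a geometric sum. Since `|sin² a - sin² b| ≤ |sin (a - b)|`, a bad `j` has `|sin u| >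
ε`. Summing `1 / sin²` over those lattice points by telescoping cotangents (`sum_one_div_sin_sq_le`)
bounds the bad weight by `1 / (Mε - π/2)`, which the choice of `m` makes at most `δ`. -/

namespace SimulAE

/-! ### Circuits as block operators on the target qubit -/

/-- The circuit `L` applies `W y j` to `R₂` when `R₁` is in `|y⟩` and `R₃` is in `|j⟩`, and the
inverse circuit applies the adjoint of `W y j`. -/
def Implements {n m : ℕ} (O : Matrix.unitaryGroup (Fin 2) ℂ) (L : Circuit n m)
    (W : Fin (2 ^ n) → Fin (2 ^ m) → Matrix (Fin 2) (Fin 2) ℂ) : Prop :=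
  (∀ ψ y b j, L.run O ψ (y, b, j) = (W y j).mulVec (fun b' => ψ (y, b', j)) b) ∧
  ∀ ψ y b j, L.inverse.run O ψ (y, b, j) = (W y j)ᴴ.mulVec (fun b' => ψ (y, b', j)) b

theorem blockOp_mulVec {n m : ℕ} (W : Fin (2 ^ n) → Fin (2 ^ m) → Matrix (Fin 2) (Fin 2) ℂ)
    (ψ : Reg n m → ℂ) (y : Fin (2 ^ n)) (b : Fin 2) (j : Fin (2 ^ m)) :
    (blockOp W).mulVec ψ (y, b, j) = (W y j).mulVec (fun b' => ψ (y, b', j)) b := by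
  simp only [Matrix.mulVec, dotProduct, blockOp, Matrix.of_apply, Fintype.sum_prod_type]
  rw [Finset.sum_eq_single y (fun y' _ h => by simp [h.symm]) (by simp)]
  refine Finset.sum_congr rfl fun b' _ => ?_
  rw [Finset.sum_eq_single j (fun j' _ h => by simp [h.symm]) (by simp)]
  simp

namespace Circuit

variable {n m : ℕ}

theorem run_append (O : Matrix.unitaryGroup (Fin 2) ℂ) (L₁ L₂ : Circuit n m) (ψ : Reg n m → ℂ) :
    run O (L₁ ++ L₂) ψ = run O L₂ (run O L₁ ψ) := by
  simp [run, List.foldl_append]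

theorem run_singleton (O : Matrix.unitaryGroup (Fin 2) ℂ) (g : Gate n m) (ψ : Reg n m → ℂ) :
    run O [g] ψ = (g.op O).mulVec ψ := rfl

theorem inverse_append (L₁ L₂ : Circuit n m) :
    inverse (L₁ ++ L₂) = inverse L₂ ++ inverse L₁ := by
  simp [inverse]

theorem queries_append (L₁ L₂ : Circuit n m) :
    queries (L₁ ++ L₂) = queries L₁ + queries L₂ := by
  simp [queries]

theorem queries_inverse (L : Circuit n m) : queries (inverse L) = queries L := by
  have h : ∀ g : Gate n m, g.inverse.cost = g.cost := fun g => by cases g <;> rfl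
  simp [queries, inverse, List.sum_reverse, Function.comp_def, h]

end Circuit

theorem Gate.inverse_inverse {n m : ℕ} (g : Gate n m) : g.inverse.inverse = g := by
  cases g <;> simp [Gate.inverse]

theorem Circuit.inverse_inverse {n m : ℕ} (L : Circuit n m) : L.inverse.inverse = L := by
  simp [Circuit.inverse, Function.comp_def, Gate.inverse_inverse]

theorem conjTranspose_flipZero : flipZeroᴴ = flipZero := by
  ext i j
  fin_cases i <;> fin_cases j <;> simp [flipZero]

namespace Implements

variable {n m : ℕ} {O : Matrix.unitaryGroup (Fin 2) ℂ} {L L₁ L₂ : Circuit n m}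
  {W W₁ W₂ : Fin (2 ^ n) → Fin (2 ^ m) → Matrix (Fin 2) (Fin 2) ℂ}

theorem congr (h : Implements O L W₁) (hW : ∀ y j, W₁ y j = W₂ y j) : Implements O L W₂ := by
  have : W₁ = W₂ := funext fun y => funext fun j => hW y j
  exact this ▸ h

theorem nil : Implements O ([] : Circuit n m) fun _ _ => 1 := by
  constructor <;> intros <;> simp [Circuit.run, Circuit.inverse]

theorem append (h₁ : Implements O L₁ W₁) (h₂ : Implements O L₂ W₂) :
    Implements O (L₁ ++ L₂) fun y j => W₂ y j * W₁ y j := by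
  constructor <;> intro ψ y b j
  · rw [Circuit.run_append, h₂.1, ← Matrix.mulVec_mulVec]
    congr 2
    funext b'
    exact h₁.1 ψ y b' j
  · rw [Circuit.inverse_append, Circuit.run_append, h₁.2, Matrix.conjTranspose_mul,
      ← Matrix.mulVec_mulVec]
    congr 2
    funext b'
    exact h₂.2 ψ y b' j

/-- Inverting a circuit swaps the two clauses of `Implements`, because inversion is involutive. This
supplies the `A†` inside the Grover step. -/
theorem inverse (h : Implements O L W) : Implements O L.inverse fun y j => (W y j)ᴴ := by
  refine ⟨h.2, ?_⟩
  simpa [Circuit.inverse_inverse] using h.1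

theorem of_op {g : Gate n m} (h : g.op O = blockOp W)
    (h' : g.inverse.op O = blockOp fun y j => (W y j)ᴴ) : Implements O [g] W := by
  constructor <;> intro ψ y b j
  · rw [Circuit.run_singleton, h, blockOp_mulVec]
  · rw [show Circuit.inverse [g] = [g.inverse] from rfl, Circuit.run_singleton, h', blockOp_mulVec]

theorem onTarget (c : Option (Fin m)) (y : Fin (2 ^ n)) (V : Matrix.unitaryGroup (Fin 2) ℂ) :
    Implements O [Gate.onTarget c y V] fun y' j =>
      if y' = y ∧ Gate.active c j = true then (V : Matrix (Fin 2) (Fin 2) ℂ) else 1 := by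
  refine of_op rfl ?_
  simp only [Gate.op, Gate.inverse]
  congr 1
  funext y' j
  split_ifs <;> simp [Matrix.star_eq_conjTranspose]

theorem flip (c : Option (Fin m)) :
    Implements O [Gate.flip c] fun (_ : Fin (2 ^ n)) j =>
      if Gate.active c j then flipZero else 1 := by
  refine of_op rfl ?_
  simp only [Gate.op, Gate.inverse]
  congr 1
  funext y' j
  split_ifs <;> simp [conjTranspose_flipZero]

theorem neg (c : Option (Fin m)) :
    Implements O [Gate.neg c] fun (_ : Fin (2 ^ n)) j => if Gate.active c j then -1 else 1 := by
  refine of_op rfl ?_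
  simp only [Gate.op, Gate.inverse]
  congr 1
  funext y' j
  split_ifs <;> simp

theorem query (c : Option (Fin m)) :
    Implements O [Gate.query c false] fun (_ : Fin (2 ^ n)) j =>
      if Gate.active c j then (O : Matrix (Fin 2) (Fin 2) ℂ) else 1 := by
  refine of_op (by simp [Gate.op]) ?_
  simp only [Gate.op, Gate.inverse]
  congr 1
  funext y' j
  split_ifs <;> simp_all

theorem layer (c : Option (Fin m)) (U : Fin (2 ^ n) → Matrix.unitaryGroup (Fin 2) ℂ) :
    Implements O (SimulAE.layer c U) fun y j =>
      if Gate.active c j then (U y : Matrix (Fin 2) (Fin 2) ℂ) else 1 := by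
  -- Rows not yet visited carry the identity; without repetition no row receives its gate twice.
  have key : ∀ l : List (Fin (2 ^ n)), l.Nodup →
      Implements O (l.map fun y => Gate.onTarget c y (U y)) fun y j =>
        if y ∈ l ∧ Gate.active c j = true then (U y : Matrix (Fin 2) (Fin 2) ℂ) else 1 := by
    intro l hl
    induction l with
    | nil => simpa using nil
    | cons a l ih =>
      rw [List.nodup_cons] at hl
      refine ((onTarget c a (U a)).append (ih hl.2)).congr fun y j => ?_
      by_cases hy : y = a
      · subst hy
        by_cases hc : Gate.active c j = true <;> simp [hl.1, hc]
      · simp [hy]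
  refine (key _ (List.nodup_finRange _)).congr fun y j => ?_
  simp

theorem prepare (c : Option (Fin m)) (U : ℕ → Fin (2 ^ n) → Matrix.unitaryGroup (Fin 2) ℂ)
    (k : ℕ) :
    Implements O (SimulAE.prepare c U k) fun y j =>
      if Gate.active c j then (algo O U y k : Matrix (Fin 2) (Fin 2) ℂ) else 1 := by
  induction k with
  | zero => exact layer c (U 0)
  | succ k ih =>
    refine ((ih.append (query c)).append (layer c (U (k + 1)))).congr fun y j => ?_
    split_ifs <;> simp [algo, mul_assoc]

/-- Every gate carries the control, so an unsatisfied control leaves a product of identities. The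
sign must be controlled too: under a control it is a relative phase. -/
theorem groverStep (c : Option (Fin m)) (U : ℕ → Fin (2 ^ n) → Matrix.unitaryGroup (Fin 2) ℂ)
    (k : ℕ) :
    Implements O (SimulAE.groverStep c U k) fun y j =>
      if Gate.active c j then grover (algo O U y k) else 1 := by
  refine (((((flip c).append (prepare c U k).inverse).append (flip c)).append
    (prepare c U k)).append (neg c)).congr fun y j => ?_
  split_ifs <;> simp [grover, mul_assoc]

theorem replicate (h : Implements O L W) (r : ℕ) :
    Implements O (List.replicate r L).flatten fun y j => W y j ^ r := by
  induction r with
  | zero => simpa using nil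
  | succ r ih =>
    rw [List.replicate_succ, List.flatten_cons]
    exact (h.append ih).congr fun y j => (pow_succ _ _).symm

end Implements

/-- Binary expansion: it assembles the powers `G ^ (2 ^ i)` controlled on the bits of `j` into `G ^
j`. -/
theorem sum_two_pow_testBit (j m : ℕ) :
    ∑ i ∈ Finset.range m, (if j.testBit i then 2 ^ i else 0) = j % 2 ^ m := by
  induction m with
  | zero => simp [Nat.mod_one]
  | succ m ih =>
    rw [Finset.sum_range_succ, ih, Nat.mod_pow_succ, Nat.testBit_eq_decide_div_mod_eq]
    rcases Nat.mod_two_eq_zero_or_one (j / 2 ^ m) with h | h <;> simp [h]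

theorem Implements.controlledPower {n m : ℕ} (O : Matrix.unitaryGroup (Fin 2) ℂ)
    (U : ℕ → Fin (2 ^ n) → Matrix.unitaryGroup (Fin 2) ℂ) (k : ℕ) :
    Implements O ((List.finRange m).flatMap
      (fun i => (List.replicate (2 ^ i.val) (SimulAE.groverStep (some i) U k)).flatten))
      fun y j => grover (algo O U y k) ^ j.val := by
  have key : ∀ l : List (Fin m), Implements O (l.flatMap
      (fun i => (List.replicate (2 ^ i.val) (SimulAE.groverStep (some i) U k)).flatten))
      fun y j => grover (algo O U y k) ^
        (l.map fun i => if j.val.testBit i.val then 2 ^ i.val else 0).sum := by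
    intro l
    induction l with
    | nil => simpa using Implements.nil
    | cons i l ih =>
      rw [List.flatMap_cons]
      refine (((Implements.groverStep (some i) U k).replicate (2 ^ i.val)).append ih).congr
        fun y j => ?_
      have hact : Gate.active (some i) j = j.val.testBit i.val := rfl
      rw [List.map_cons, List.sum_cons, add_comm, pow_add, hact]
      split_ifs <;> simp
  refine (key (List.finRange m)).congr fun y j => ?_
  rw [← Fin.sum_univ_def, Fin.sum_univ_eq_sum_range (fun i => if j.val.testBit i then 2 ^ i else 0),
    sum_two_pow_testBit, Nat.mod_eq_of_lt j.isLt]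

/-! ### Query count -/

theorem queries_layer {n m : ℕ} (c : Option (Fin m))
    (W : Fin (2 ^ n) → Matrix.unitaryGroup (Fin 2) ℂ) : (layer c W).queries = 0 := by
  simp [layer, Circuit.queries, Function.comp_def, Gate.cost]

theorem queries_prepare {n m : ℕ} (c : Option (Fin m))
    (U : ℕ → Fin (2 ^ n) → Matrix.unitaryGroup (Fin 2) ℂ) (k : ℕ) :
    (prepare c U k).queries = k := by
  induction k with
  | zero => exact queries_layer _ _
  | succ k ih =>
    rw [prepare, Circuit.queries_append, Circuit.queries_append, ih, queries_layer]
    rfl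

theorem queries_groverStep {n m : ℕ} (c : Option (Fin m))
    (U : ℕ → Fin (2 ^ n) → Matrix.unitaryGroup (Fin 2) ℂ) (k : ℕ) :
    (groverStep c U k).queries = 2 * k := by
  simp only [groverStep, Circuit.queries_append, Circuit.queries_inverse, queries_prepare]
  simp [Circuit.queries, Gate.cost, two_mul]

theorem queries_replicate {n m : ℕ} (L : Circuit n m) (r : ℕ) :
    Circuit.queries (List.replicate r L).flatten = r * L.queries := by
  induction r with
  | zero => simp [Circuit.queries]
  | succ r ih =>
    rw [List.replicate_succ, List.flatten_cons, Circuit.queries_append, ih]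
    ring

/-- The preparation costs `k`, each Grover step `2k` (one `A` and one `A†`), and there are `∑ 2 ^ i
= 2 ^ m - 1` Grover steps. -/
theorem queries_simulAE {n m : ℕ} (V : Matrix.unitaryGroup (Fin (2 ^ n)) ℂ)
    (U : ℕ → Fin (2 ^ n) → Matrix.unitaryGroup (Fin 2) ℂ) (k : ℕ) :
    (simulAE m V U k).queries = k + (2 ^ m - 1) * (2 * k) := by
  have key : ∀ l : List (Fin m), Circuit.queries (l.flatMap
      (fun i => (List.replicate (2 ^ i.val) (groverStep (some i) U k)).flatten)) =
      (l.map fun i => 2 ^ i.val).sum * (2 * k) := by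
    intro l
    induction l with
    | nil => simp [Circuit.queries]
    | cons i l ih =>
      rw [List.flatMap_cons, Circuit.queries_append, ih, queries_replicate, queries_groverStep,
        List.map_cons, List.sum_cons, add_mul]
  have hsum : ((List.finRange m).map fun i => 2 ^ i.val).sum = 2 ^ m - 1 := by
    rw [← Fin.sum_univ_def, Fin.sum_univ_eq_sum_range (fun i => 2 ^ i)]
    simpa using Nat.geomSum_eq (le_refl 2) m
  simp only [simulAE, Circuit.queries_append, queries_prepare, key, hsum]
  simp [Circuit.queries, Gate.cost]

/-! ### The output state -/

theorem fourier_mulVec {n m : ℕ} (F : Matrix (Fin (2 ^ m)) (Fin (2 ^ m)) ℂ) (ψ : Reg n m → ℂ)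
    (y : Fin (2 ^ n)) (b : Fin 2) (j : Fin (2 ^ m)) :
    ((1 : Matrix (Fin (2 ^ n)) (Fin (2 ^ n)) ℂ) ⊗ₖ
      ((1 : Matrix (Fin 2) (Fin 2) ℂ) ⊗ₖ F)).mulVec ψ (y, b, j) = ∑ l, F j l * ψ (y, b, l) := by
  simp [Matrix.mulVec, dotProduct, Fintype.sum_prod_type, Matrix.one_apply]

theorem one_kronecker_mulVec {d : ℕ} (F : Matrix (Fin d) (Fin d) ℂ) (ψ : Fin 2 × Fin d → ℂ)
    (b : Fin 2) (j : Fin d) :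
    ((1 : Matrix (Fin 2) (Fin 2) ℂ) ⊗ₖ F).mulVec ψ (b, j) = ∑ l, F j l * ψ (b, l) := by
  simp [Matrix.mulVec, dotProduct, Fintype.sum_prod_type, Matrix.one_apply]

theorem estimated_apply (m : ℕ) (A : Matrix.unitaryGroup (Fin 2) ℂ) (b : Fin 2)
    (j : Fin (2 ^ m)) :
    estimated m A (b, j) =
      ∑ x, (qft m)ᴴ j x * (qft m x 0 * (grover A ^ x.val).mulVec (prepared A) b) := by
  rw [estimated, ampEst, ← Matrix.mulVec_mulVec, ← Matrix.mulVec_mulVec, one_kronecker_mulVec]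
  refine Finset.sum_congr rfl fun x _ => ?_
  congr 1
  have hF : ∀ b' x', ((1 : Matrix (Fin 2) (Fin 2) ℂ) ⊗ₖ qft m).mulVec
      (fun p => prepared A p.1 * (Pi.single 0 1 : Fin (2 ^ m) → ℂ) p.2) (b', x') =
      qft m x' 0 * prepared A b' := fun b' x' => by
    rw [one_kronecker_mulVec]
    simp [Pi.single_apply]
  rw [Matrix.mulVec, dotProduct, Fintype.sum_prod_type, Matrix.mulVec, dotProduct, Finset.mul_sum]
  refine Finset.sum_congr rfl fun b' _ => ?_
  rw [Finset.sum_eq_single x (fun x' _ h => by simp [h.symm]) (by simp), hF]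
  simp only [Matrix.of_apply, if_true]
  ring

theorem run_simulAE {n m : ℕ} (O : Matrix.unitaryGroup (Fin 2) ℂ)
    (V : Matrix.unitaryGroup (Fin (2 ^ n)) ℂ)
    (U : ℕ → Fin (2 ^ n) → Matrix.unitaryGroup (Fin 2) ℂ) (k : ℕ)
    (y : Fin (2 ^ n)) (b : Fin 2) (j : Fin (2 ^ m)) :
    Circuit.run O (simulAE m V U k) (Pi.single (0, 0, 0) 1) (y, b, j) =
      prepared V y * estimated m (algo O U y k) (b, j) := by
  have h₀ : ∀ y b j, Circuit.run O ([Gate.onIndex V] ++ prepare none U k)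
      (Pi.single (0, 0, 0) 1) (y, b, j) =
      prepared V y * prepared (algo O U y k) b * (Pi.single 0 1 : Fin (2 ^ m) → ℂ) j := by
    intro y b j
    rw [Circuit.run_append, (Implements.prepare none U k).1]
    simp only [Circuit.run_singleton, Gate.op, Gate.active, prepared]
    simp [Matrix.mulVec, dotProduct, Pi.single_apply, Matrix.one_apply, Prod.ext_iff,
      Fintype.sum_prod_type, ite_and]
    split_ifs <;> ring
  rw [simulAE, Circuit.run_append, Circuit.run_singleton, Circuit.run_append, Circuit.run_append]
  simp only [Gate.op, if_true]
  rw [fourier_mulVec, estimated_apply, Finset.mul_sum]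
  refine Finset.sum_congr rfl fun x _ => ?_
  rw [(Implements.controlledPower O U k).1]
  have hF : ∀ b', Circuit.run O [Gate.fourier false] (Circuit.run O ([Gate.onIndex V] ++
      prepare none U k) (Pi.single (0, 0, 0) 1)) (y, b', x) =
      qft m x 0 * (prepared V y * prepared (algo O U y k) b') := fun b' => by
    rw [Circuit.run_singleton]
    simp only [Gate.op, Bool.false_eq_true, if_false]
    rw [fourier_mulVec]
    simp only [h₀]
    simp [Pi.single_apply]
  simp only [hF, Matrix.mulVec, dotProduct, Finset.mul_sum]
  refine Finset.sum_congr rfl fun b' _ => ?_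
  ring

/-! ### A lattice sum of `1 / sin²` -/

theorem cot_sub_cot {a b : ℝ} (ha : Real.sin a ≠ 0) (hb : Real.sin b ≠ 0) :
    Real.cot a - Real.cot b = Real.sin (b - a) / (Real.sin a * Real.sin b) := by
  rw [Real.cot_eq_cos_div_sin, Real.cot_eq_cos_div_sin, Real.sin_sub]
  field_simp

theorem cot_antitone {a b : ℝ} (ha : 0 < a) (hab : a ≤ b) (hb : b < Real.pi) :
    Real.cot b ≤ Real.cot a := by
  have h1 := Real.sin_pos_of_pos_of_lt_pi ha (hab.trans_lt hb)
  have h2 := Real.sin_pos_of_pos_of_lt_pi (ha.trans_le hab) hb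
  have h3 := Real.sin_nonneg_of_nonneg_of_le_pi (sub_nonneg.2 hab) (by linarith)
  have := cot_sub_cot h1.ne' h2.ne'
  have : 0 ≤ Real.cot a - Real.cot b := by rw [this]; positivity
  linarith

theorem cot_le_inv {x : ℝ} (hx : 0 < x) (hx' : x < Real.pi / 2) : Real.cot x ≤ 1 / x := by
  rw [← Real.tan_inv_eq_cot, inv_eq_one_div]
  exact one_div_le_one_div_of_le hx (Real.lt_tan hx hx').le

/-- The cotangent difference is `sin h / (sin (x - h/2) sin (x + h/2))`, and the denominator equals
`sin² x - sin² (h/2) ≤ sin² x`. On a lattice of mesh `h` these bounds telescope. -/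
theorem one_div_sin_sq_le {x h : ℝ} (hh : 0 < h) (h1 : 0 < x - h / 2)
    (h2 : x + h / 2 < Real.pi) :
    1 / Real.sin x ^ 2 ≤ (Real.cot (x - h / 2) - Real.cot (x + h / 2)) / Real.sin h := by
  have s1 := Real.sin_pos_of_pos_of_lt_pi h1 (by linarith)
  have s2 := Real.sin_pos_of_pos_of_lt_pi (by linarith : 0 < x + h / 2) h2
  have s3 := Real.sin_pos_of_pos_of_lt_pi hh (by linarith)
  have s4 := Real.sin_pos_of_pos_of_lt_pi (by linarith : 0 < x) (by linarith)
  rw [cot_sub_cot s1.ne' s2.ne', show x + h / 2 - (x - h / 2) = h by ring, div_right_comm,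
    div_self s3.ne']
  refine one_div_le_one_div_of_le (by positivity) ?_
  rw [Real.sin_sub, Real.sin_add]
  nlinarith [Real.sin_sq_add_cos_sq x, Real.sin_sq_add_cos_sq (h / 2), sq_nonneg (Real.sin (h / 2))]

theorem sum_range_add_eq_of_periodic {f : ℤ → ℝ} {N : ℕ} (hf : ∀ j, f (j + N) = f j) (a : ℤ) :
    ∑ i ∈ Finset.range N, f (a + i) = ∑ i ∈ Finset.range N, f i := by
  have step : ∀ a : ℤ, ∑ i ∈ Finset.range N, f (a + 1 + i) = ∑ i ∈ Finset.range N, f (a + i) := by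
    intro a
    have h1 := Finset.sum_range_succ (fun i : ℕ => f (a + i)) N
    have h2 := Finset.sum_range_succ' (fun i : ℕ => f (a + i)) N
    have h3 : ∀ i : ℕ, f (a + 1 + i) = f (a + (i + 1 : ℕ)) := fun i => by
      congr 1; push_cast; ring
    simp only [h3]
    rw [h1, hf] at h2
    simpa using h2.symm
  induction a with
  | zero => simp
  | succ a ih => rw [step, ih]
  | pred a ih => rw [← step, sub_add_cancel, ih]

/-- Summing `1 / sin²` over the points of a lattice of mesh `π / N` at which `|sin|` exceeds `ε`. -/
theorem sum_one_div_sin_sq_le {N : ℕ} (hN : 2 ≤ N) (t ε : ℝ) (hε1 : ε ≤ 1)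
    (hε : Real.pi / (2 * N) < ε) :
    ∑ j ∈ Finset.range N, (if ε < |Real.sin (Real.pi * (j - t) / N)| then
        1 / Real.sin (Real.pi * (j - t) / N) ^ 2 else 0) ≤
      N / (ε - Real.pi / (2 * N)) := by
  have hN0 : (0 : ℝ) < N := by exact_mod_cast (by omega : 0 < N)
  have hN2 : (2 : ℝ) ≤ N := by exact_mod_cast hN
  have hpi := Real.pi_pos
  set h : ℝ := Real.pi / N with hh
  have hh0 : 0 < h := by positivity
  have hh2 : Real.pi / (2 * N) = h / 2 := by rw [hh]; field_simp
  rw [hh2] at hε ⊢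
  have hhpi : h ≤ Real.pi / 2 := by
    rw [hh]; exact div_le_div_of_nonneg_left hpi.le (by norm_num) hN2
  have hε0 : 0 < ε := by linarith
  -- Inside `[0, π)` the condition `|sin x| > ε` means `θ < x < π - θ`.
  set θ := Real.arcsin ε with hθ
  have hθpi : θ ≤ Real.pi / 2 := Real.arcsin_le_pi_div_two _
  have hsinθ : Real.sin θ = ε := Real.sin_arcsin (by linarith) hε1
  have hθ0 : 0 < θ := Real.arcsin_pos.2 hε0
  have hεθ : ε ≤ θ := hsinθ ▸ Real.sin_le hθ0.le
  set f : ℤ → ℝ := fun j => if ε < |Real.sin (Real.pi * (j - t) / N)| then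
        1 / Real.sin (Real.pi * (j - t) / N) ^ 2 else 0 with hf
  have hper : ∀ j, f (j + N) = f j := by
    intro j
    have : Real.pi * (((j + N : ℤ) : ℝ) - t) / N = Real.pi * (j - t) / N + Real.pi := by
      push_cast; field_simp; ring
    simp only [hf, this, Real.sin_add_pi, abs_neg, neg_sq]
  -- By periodicity the sum may start at `⌈t⌉`, which puts all `N` lattice points into `[0, π)`.
  set a : ℤ := ⌈t⌉ with ha
  have hsum := sum_range_add_eq_of_periodic hper a
  simp only [hf, Int.cast_natCast] at hsum
  rw [← hsum]
  set x : ℕ → ℝ := fun i => h * (i + (a - t)) with hx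
  have ha0 : 0 ≤ (a : ℝ) - t := sub_nonneg.2 (Int.le_ceil t)
  have ha1 : (a : ℝ) - t < 1 := by linarith [Int.ceil_lt_add_one t]
  -- Clamping keeps the cotangents away from their poles and lets the telescope run over all `i`: it
  -- fixes both endpoints of a counted cell, and elsewhere the difference is still nonnegative.
  set c : ℝ → ℝ := fun u => max (θ - h / 2) (min u (Real.pi - θ + h / 2)) with hc
  have hc_mono : Monotone c := fun u v huv => max_le_max le_rfl (min_le_min huv le_rfl)
  have hc_pos : ∀ u, θ - h / 2 ≤ c u := fun u => le_max_left _ _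
  have hc_lt : ∀ u, c u ≤ Real.pi - θ + h / 2 := fun u =>
    max_le (by linarith) (min_le_right _ _)
  have hsinh : 2 / N ≤ Real.sin h := by
    have := Real.mul_le_sin hh0.le hhpi
    rwa [hh, show 2 / Real.pi * (Real.pi / N) = 2 / N by field_simp] at this
  have hsinh0 : 0 < Real.sin h := lt_of_lt_of_le (by positivity) hsinh
  set D : ℕ → ℝ := fun i => Real.cot (c (x i - h / 2)) / Real.sin h with hD
  have hterm : ∀ i ∈ Finset.range N,
      (if ε < |Real.sin (Real.pi * (((a + i : ℤ) : ℝ) - t) / N)| then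
        1 / Real.sin (Real.pi * (((a + i : ℤ) : ℝ) - t) / N) ^ 2 else 0) ≤ D i - D (i + 1) := by
    intro i hi
    have hiN : (i : ℝ) + 1 ≤ N := by exact_mod_cast Finset.mem_range.1 hi
    have hxi : Real.pi * (((a + i : ℤ) : ℝ) - t) / N = x i := by
      simp only [hx, hh]; push_cast; ring
    have hx0 : 0 ≤ x i := by simp only [hx]; positivity
    have hxpi : x i < Real.pi := by
      have : x i < h * N := mul_lt_mul_of_pos_left (by linarith) hh0
      rwa [hh, div_mul_cancel₀ _ hN0.ne'] at this
    have hx1 : x (i + 1) - h / 2 = x i + h / 2 := by simp only [hx]; push_cast; ring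
    rw [hxi]
    simp only [hD, hx1, ← sub_div]
    split_ifs with hbad
    · rw [abs_of_nonneg (Real.sin_nonneg_of_nonneg_of_le_pi hx0 hxpi.le)] at hbad
      have hl : θ < x i := by
        by_contra! hcon
        have := Real.sin_le_sin_of_le_of_le_pi_div_two (by linarith) hθpi hcon
        linarith
      have hr : x i < Real.pi - θ := by
        by_contra! hcon
        have := Real.sin_le_sin_of_le_of_le_pi_div_two (x := Real.pi - x i) (by linarith) hθpi
          (by linarith)
        rw [Real.sin_pi_sub] at this
        linarith
      have e1 : c (x i - h / 2) = x i - h / 2 := by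
        simp only [hc]; rw [min_eq_left (by linarith), max_eq_right (by linarith)]
      have e2 : c (x i + h / 2) = x i + h / 2 := by
        simp only [hc]; rw [min_eq_left (by linarith), max_eq_right (by linarith)]
      rw [e1, e2]
      exact one_div_sin_sq_le hh0 (by linarith) (by linarith)
    · refine div_nonneg (sub_nonneg.2 (cot_antitone ?_ (hc_mono (by linarith)) ?_)) hsinh0.le
      · linarith [hc_pos (x i - h / 2)]
      · linarith [hc_lt (x i + h / 2)]
  refine (Finset.sum_le_sum hterm).trans ?_
  rw [Finset.sum_range_sub']
  simp only [hD, ← sub_div]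
  -- The two ends together contribute at most `2 cot (θ - h/2) ≤ 2 / (ε - h/2)`; Jordan's bound `sin
  -- h ≥ 2/N` turns the 2 into `N`.
  have u1 : Real.cot (c (x 0 - h / 2)) ≤ Real.cot (θ - h / 2) :=
    cot_antitone (by linarith) (hc_pos _) (by linarith [hc_lt (x 0 - h / 2)])
  have u2 : Real.cot (Real.pi - θ + h / 2) ≤ Real.cot (c (x N - h / 2)) :=
    cot_antitone (by linarith [hc_pos (x N - h / 2)]) (hc_lt _) (by linarith)
  have u3 : Real.cot (Real.pi - θ + h / 2) = -Real.cot (θ - h / 2) := by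
    rw [show Real.pi - θ + h / 2 = Real.pi - (θ - h / 2) by ring, Real.cot_eq_cos_div_sin,
      Real.cot_eq_cos_div_sin, Real.sin_pi_sub, Real.cos_pi_sub, neg_div]
  have u4 : Real.cot (θ - h / 2) ≤ 1 / (ε - h / 2) :=
    (cot_le_inv (by linarith) (by linarith)).trans
      (one_div_le_one_div_of_le (by linarith) (by linarith))
  rw [div_le_iff₀ hsinh0]
  have hpos : 0 < 1 / (ε - h / 2) := by have : 0 < ε - h / 2 := by linarith
                                        positivity
  calc _ ≤ 2 * (1 / (ε - h / 2)) := by linarith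
    _ = N / (ε - h / 2) * (2 / N) := by field_simp
    _ ≤ _ := mul_le_mul_of_nonneg_left hsinh (by rw [← mul_one_div]; positivity)

/-! ### Fourier transform and phase estimation -/

theorem sum_norm_sq_mulVec {ι : Type*} [Fintype ι] [DecidableEq ι] {F : Matrix ι ι ℂ}
    (hF : Fᴴ * F = 1) (v : ι → ℂ) : ∑ i, ‖F.mulVec v i‖ ^ 2 = ∑ i, ‖v i‖ ^ 2 := by
  have key : ∀ w : ι → ℂ, ((∑ i, ‖w i‖ ^ 2 : ℝ) : ℂ) = star w ⬝ᵥ w := fun w => by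
    simp [dotProduct, Complex.conj_mul']
  have : ((∑ i, ‖F.mulVec v i‖ ^ 2 : ℝ) : ℂ) = ((∑ i, ‖v i‖ ^ 2 : ℝ) : ℂ) := by
    rw [key, key, Matrix.star_mulVec, Matrix.dotProduct_mulVec, Matrix.vecMul_vecMul, hF,
      Matrix.vecMul_one]
  exact_mod_cast this

theorem sum_norm_sq_prepared {d : ℕ} [NeZero d] (A : Matrix.unitaryGroup (Fin d) ℂ) :
    ∑ b, ‖prepared A b‖ ^ 2 = 1 := by
  simp only [prepared]
  rw [sum_norm_sq_mulVec (Matrix.mem_unitaryGroup_iff'.1 A.2)]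
  simp [Pi.single_apply, apply_ite norm, ite_pow]

theorem sqrt_two_pow_mul_self (m : ℕ) :
    ((Real.sqrt (2 ^ m) : ℝ) : ℂ) * (Real.sqrt (2 ^ m) : ℝ) = 2 ^ m := by
  rw [← Complex.ofReal_mul, Real.mul_self_sqrt (by positivity)]
  simp

theorem star_qft (m : ℕ) (j l : Fin (2 ^ m)) :
    (starRingEnd ℂ) (qft m j l) =
      Complex.exp (-(2 * Real.pi * Complex.I * (j.val : ℂ) * (l.val : ℂ) / (2 ^ m : ℂ))) /
        (Real.sqrt (2 ^ m) : ℂ) := by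
  have h2 : (starRingEnd ℂ) (2 ^ m : ℂ) = 2 ^ m := by rw [map_pow, map_ofNat]
  simp only [qft, Matrix.of_apply, map_div₀, ← Complex.exp_conj, map_mul, Complex.conj_I,
    Complex.conj_ofReal, map_natCast, h2, map_ofNat]
  congr 2
  ring

theorem qft_conjTranspose_mul_self (m : ℕ) : (qft m)ᴴ * qft m = 1 := by
  have hM : (2 ^ m : ℂ) ≠ 0 := pow_ne_zero _ two_ne_zero
  ext j l
  set w : ℂ := Complex.exp (2 * Real.pi * Complex.I * (((l.val : ℂ) - j.val) / 2 ^ m)) with hw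
  have hterm : ∀ x : Fin (2 ^ m), (qft m)ᴴ j x * qft m x l = w ^ x.val / 2 ^ m := by
    intro x
    rw [Matrix.conjTranspose_apply, ← starRingEnd_apply, star_qft]
    simp only [qft, Matrix.of_apply]
    rw [div_mul_div_comm, sqrt_two_pow_mul_self, ← Complex.exp_add, hw, ← Complex.exp_nat_mul]
    congr 2
    ring
  rw [Matrix.mul_apply, Finset.sum_congr rfl fun x _ => hterm x, ← Finset.sum_div,
    Fin.sum_univ_eq_sum_range (fun x => w ^ x)]
  by_cases hjl : j = l
  · subst hjl
    simp [hw, hM]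
  · have hw1 : w ≠ 1 := by
      intro h
      rw [hw, Complex.exp_eq_one_iff] at h
      obtain ⟨z, hz⟩ := h
      have h2 : (2 * Real.pi * Complex.I : ℂ) ≠ 0 := Complex.two_pi_I_ne_zero
      rw [mul_comm (z : ℂ)] at hz
      have h3 := mul_left_cancel₀ h2 hz
      rw [div_eq_iff hM] at h3
      have h4 : (l.val : ℤ) - j.val = z * 2 ^ m := by exact_mod_cast h3
      have h5 : (l.val : ℤ) < 2 ^ m := by exact_mod_cast l.isLt
      have h6 : (j.val : ℤ) < 2 ^ m := by exact_mod_cast j.isLt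
      -- Distinct labels differ by less than `2 ^ m`, so the ratio `w` is a nontrivial root of
      -- unity.
      have h7 : z = 0 := by
        have h8 : z < 1 := by by_contra! hc; nlinarith
        have h9 : -1 < z := by by_contra! hc; nlinarith
        omega
      rw [h7] at h4
      exact hjl (Fin.ext (by omega))
    have hwM : w ^ (2 ^ m) = 1 := by
      rw [hw, ← Complex.exp_nat_mul, Complex.exp_eq_one_iff]
      refine ⟨(l.val : ℤ) - j.val, ?_⟩
      push_cast
      field_simp
    rw [geom_sum_eq hw1, hwM, Matrix.one_apply_ne hjl]
    simp

/-- The state of the estimate register after phase estimation on an eigenvector with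
eigenvalue `exp (2 i φ)`. -/
noncomputable def phaseState (m : ℕ) (φ : ℝ) (j : Fin (2 ^ m)) : ℂ :=
  ∑ x, (qft m)ᴴ j x * (qft m x 0 * Complex.exp (2 * φ * Complex.I) ^ x.val)

theorem norm_qft_zero_sq (m : ℕ) (x : Fin (2 ^ m)) : ‖qft m x 0‖ ^ 2 = 1 / 2 ^ m := by
  simp [qft, abs_of_nonneg]

theorem norm_exp_two_mul_I (φ : ℝ) : ‖Complex.exp (2 * φ * Complex.I)‖ = 1 := by
  rw [← Complex.norm_exp_ofReal_mul_I (2 * φ)]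
  push_cast
  rfl

theorem sum_norm_sq_phaseState (m : ℕ) (φ : ℝ) : ∑ j, ‖phaseState m φ j‖ ^ 2 = 1 := by
  have h : ((qft m)ᴴ)ᴴ * (qft m)ᴴ = 1 := by
    rw [Matrix.conjTranspose_conjTranspose]
    exact mul_eq_one_comm.1 (qft_conjTranspose_mul_self m)
  refine (sum_norm_sq_mulVec h _).trans ?_
  simp [norm_qft_zero_sq, norm_exp_two_mul_I]

theorem norm_exp_two_mul_I_sub_one (u : ℝ) :
    ‖Complex.exp (2 * u * Complex.I) - 1‖ = 2 * |Real.sin u| := by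
  have := Complex.norm_exp_I_mul_ofReal_sub_one (2 * u)
  rw [mul_div_cancel_left₀ u two_ne_zero, norm_mul, Real.norm_eq_abs, Real.norm_eq_abs,
    abs_two] at this
  rw [← this]
  congr 3
  push_cast
  ring

/-- The amplitude is a geometric sum of ratio `w = exp (-2iu)` divided by `2 ^ m`; its numerator is
at most 2 in norm and `|w - 1| = 2 |sin u|`. -/
theorem norm_sq_phaseState_le (m : ℕ) (φ : ℝ) (j : Fin (2 ^ m))
    (hs : Real.sin (Real.pi * (j.val - 2 ^ m * φ / Real.pi) / 2 ^ m) ≠ 0) :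
    ‖phaseState m φ j‖ ^ 2 ≤
      1 / (2 ^ m) ^ 2 *
        (1 / Real.sin (Real.pi * (j.val - 2 ^ m * φ / Real.pi) / 2 ^ m) ^ 2) := by
  have hM : (2 ^ m : ℂ) ≠ 0 := pow_ne_zero _ two_ne_zero
  set u : ℝ := Real.pi * (j.val - 2 ^ m * φ / Real.pi) / 2 ^ m with hu
  have hu' : u = Real.pi * j.val / 2 ^ m - φ := by
    rw [hu]
    field_simp
  set w : ℂ := Complex.exp (2 * (-u : ℝ) * Complex.I) with hw
  have hsum : phaseState m φ j = (∑ x ∈ Finset.range (2 ^ m), w ^ x) / 2 ^ m := by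
    rw [phaseState, ← Fin.sum_univ_eq_sum_range (fun x => w ^ x), Finset.sum_div]
    refine Finset.sum_congr rfl fun x _ => ?_
    rw [Matrix.conjTranspose_apply, ← starRingEnd_apply, star_qft]
    simp only [qft, Matrix.of_apply, Fin.val_zero, Nat.cast_zero, mul_zero, zero_div,
      Complex.exp_zero]
    rw [← mul_assoc, div_mul_div_comm, sqrt_two_pow_mul_self, mul_one, ← Complex.exp_nat_mul, hw,
      ← Complex.exp_nat_mul, div_mul_eq_mul_div, ← Complex.exp_add, hu']
    congr 2
    push_cast
    ring
  have hw1 : ‖w - 1‖ = 2 * |Real.sin u| := by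
    rw [hw, norm_exp_two_mul_I_sub_one, Real.sin_neg, abs_neg]
  have hsu : 0 < |Real.sin u| := abs_pos.2 hs
  have hwne : w ≠ 1 := by
    intro h
    rw [h, sub_self, norm_zero] at hw1
    linarith
  have hnw : ‖w‖ = 1 := norm_exp_two_mul_I _
  have hnum : ‖w ^ (2 ^ m) - 1‖ ≤ 2 := by
    refine (norm_sub_le _ _).trans ?_
    rw [norm_pow, hnw]
    norm_num
  rw [hsum, geom_sum_eq hwne, norm_div, norm_div, hw1, norm_pow, Complex.norm_ofNat, div_pow,
    div_pow, mul_pow, sq_abs]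
  have h4 : ‖w ^ (2 ^ m) - 1‖ ^ 2 ≤ 4 := by nlinarith [norm_nonneg (w ^ (2 ^ m) - 1)]
  have hs2 : 0 < Real.sin u ^ 2 := by positivity
  have hMr : (0 : ℝ) < (2 ^ m) ^ 2 := by positivity
  calc ‖w ^ 2 ^ m - 1‖ ^ 2 / (2 ^ 2 * Real.sin u ^ 2) / (2 ^ m) ^ 2
      ≤ 4 / (2 ^ 2 * Real.sin u ^ 2) / (2 ^ m) ^ 2 := by gcongr
    _ = _ := by field_simp; norm_num

/-- The difference factors as `sin (a - b) sin (a + b)`. Thus the phase error alone controls the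
error of the estimate, uniformly in the phase. -/
theorem abs_sin_sq_sub_sin_sq_le (a b : ℝ) :
    |Real.sin a ^ 2 - Real.sin b ^ 2| ≤ |Real.sin (a - b)| := by
  have : Real.sin a ^ 2 - Real.sin b ^ 2 = Real.sin (a - b) * Real.sin (a + b) := by
    rw [Real.sin_sub, Real.sin_add]
    nlinarith [Real.sin_sq_add_cos_sq a, Real.sin_sq_add_cos_sq b]
  rw [this, abs_mul]
  exact mul_le_of_le_one_right (abs_nonneg _) (Real.abs_sin_le_one _)

theorem phaseState_good (m : ℕ) (φ ε δ : ℝ) (hε1 : ε ≤ 1) (hm : 1 ≤ m)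
    (hbig : Real.pi / 2 < 2 ^ m * ε) (hδ : 1 / (2 ^ m * ε - Real.pi / 2) ≤ δ) :
    1 - δ ≤ ∑ j ∈ goodOutcomes m (Real.sin φ ^ 2) ε, ‖phaseState m φ j‖ ^ 2 := by
  have hM : (0 : ℝ) < 2 ^ m := by positivity
  have hpi := Real.pi_pos
  have hε0 : 0 < ε := by
    by_contra! h
    nlinarith
  have htot := sum_norm_sq_phaseState m φ
  rw [← Finset.sum_filter_add_sum_filter_not Finset.univ
    (fun j : Fin (2 ^ m) => |Real.sin (j.val * Real.pi / 2 ^ m) ^ 2 - Real.sin φ ^ 2| ≤ ε)] at htot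
  change ∑ j ∈ goodOutcomes m (Real.sin φ ^ 2) ε, ‖phaseState m φ j‖ ^ 2 + _ = 1 at htot
  suffices h : ∑ j : Fin (2 ^ m) with
      ¬ |Real.sin (j.val * Real.pi / 2 ^ m) ^ 2 - Real.sin φ ^ 2| ≤ ε,
      ‖phaseState m φ j‖ ^ 2 ≤ δ by linarith
  rw [Finset.sum_filter]
  set t : ℝ := 2 ^ m * φ / Real.pi with ht
  have hterm : ∀ j : Fin (2 ^ m),
      (if ¬ |Real.sin (j.val * Real.pi / 2 ^ m) ^ 2 - Real.sin φ ^ 2| ≤ ε then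
        ‖phaseState m φ j‖ ^ 2 else 0) ≤
      1 / (2 ^ m) ^ 2 * (if ε < |Real.sin (Real.pi * (j.val - t) / 2 ^ m)| then
        1 / Real.sin (Real.pi * (j.val - t) / 2 ^ m) ^ 2 else 0) := by
    intro j
    by_cases hb : |Real.sin (j.val * Real.pi / 2 ^ m) ^ 2 - Real.sin φ ^ 2| ≤ ε
    · rw [if_neg (not_not.2 hb)]
      split_ifs <;> positivity
    · have harg : Real.pi * (j.val - t) / 2 ^ m = j.val * Real.pi / 2 ^ m - φ := by
        rw [ht]
        field_simp
      have hlt : ε < |Real.sin (Real.pi * (j.val - t) / 2 ^ m)| := by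
        rw [harg]
        exact (not_le.1 hb).trans_le (abs_sin_sq_sub_sin_sq_le _ _)
      rw [if_pos hb, if_pos hlt]
      exact norm_sq_phaseState_le m φ j (abs_pos.1 (hε0.trans hlt))
  refine (Finset.sum_le_sum fun j _ => hterm j).trans ?_
  rw [← Finset.mul_sum, Fin.sum_univ_eq_sum_range
    (fun j : ℕ => if ε < |Real.sin (Real.pi * (j - t) / 2 ^ m)| then
        1 / Real.sin (Real.pi * (j - t) / 2 ^ m) ^ 2 else 0)]
  have hN : 2 ≤ 2 ^ m := by simpa using Nat.pow_le_pow_right (n := 2) (by norm_num) hm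
  have hmesh : Real.pi / (2 * (2 ^ m : ℕ)) < ε := by
    push_cast
    rw [div_lt_iff₀ (by positivity)]
    linarith
  have := sum_one_div_sin_sq_le hN t ε hε1 hmesh
  push_cast at this hmesh
  refine (mul_le_mul_of_nonneg_left this (by positivity)).trans (le_of_eq_of_le ?_ hδ)
  have hd : 2 ^ m * ε - Real.pi / 2 = 2 ^ m * (ε - Real.pi / (2 * 2 ^ m)) := by field_simp
  have hd0 : ε - Real.pi / (2 * 2 ^ m) ≠ 0 := by linarith
  rw [hd]
  generalize ε - Real.pi / (2 * 2 ^ m) = r at hd0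
  field_simp

/-! ### The number of estimate qubits -/

theorem two_pow_estimateQubits (ε δ : ℝ) :
    (2 : ℝ) ^ estimateQubits ε δ = 8 * 2 ^ ⌈Real.logb 2 (1 / ε)⌉₊ *
      (if 1 - 8 / Real.pi ^ 2 ≤ δ then 1 else 2 ^ ⌈Real.logb 2 (1 / δ)⌉₊) := by
  rw [estimateQubits, pow_add, pow_add]
  split_ifs <;> ring

theorem le_two_pow_ceil_logb {x : ℝ} (hx : 0 < x) : x ≤ 2 ^ ⌈Real.logb 2 x⌉₊ := by
  have h := Real.rpow_le_rpow_of_exponent_le (one_le_two : (1 : ℝ) ≤ 2)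
    (Nat.le_ceil (Real.logb 2 x))
  rwa [Real.rpow_logb (by norm_num) (by norm_num) hx, Real.rpow_natCast] at h

theorem two_pow_ceil_logb_le {x : ℝ} (hx : 1 ≤ x) : 2 ^ ⌈Real.logb 2 x⌉₊ ≤ 2 * x := by
  have h := Real.rpow_le_rpow_of_exponent_le (one_le_two : (1 : ℝ) ≤ 2)
    (Nat.ceil_lt_add_one (Real.logb_nonneg one_lt_two hx)).le
  rwa [Real.rpow_add_one (by norm_num), Real.rpow_logb (by norm_num) (by norm_num) (by linarith),
    Real.rpow_natCast, mul_comm] at h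

theorem two_pow_estimateQubits_le {ε δ : ℝ} (hε : 0 < ε) (hε1 : ε ≤ 1) (hδ : 0 < δ)
    (hδ1 : δ < 1) : (2 : ℝ) ^ estimateQubits ε δ ≤ 32 / (ε * δ) := by
  have h1 := two_pow_ceil_logb_le (one_le_one_div hε hε1)
  have h2 := two_pow_ceil_logb_le (one_le_one_div hδ hδ1.le)
  have h3 := one_le_one_div hδ hδ1.le
  have h4 : (if 1 - 8 / Real.pi ^ 2 ≤ δ then (1 : ℝ) else 2 ^ ⌈Real.logb 2 (1 / δ)⌉₊) ≤
      2 * (1 / δ) := by split_ifs <;> linarith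
  rw [two_pow_estimateQubits]
  -- The 8 comes from the three extra qubits; rounding up each logarithm costs a factor of at most
  -- 2.
  calc _ ≤ 8 * (2 * (1 / ε)) * (2 * (1 / δ)) := by gcongr
    _ = _ := by field_simp; norm_num

theorem estimateQubits_spec {ε δ : ℝ} (hε : 0 < ε) (hδ : 0 < δ) :
    Real.pi / 2 < 2 ^ estimateQubits ε δ * ε ∧
      1 / (2 ^ estimateQubits ε δ * ε - Real.pi / 2) ≤ δ := by
  have hpi := Real.pi_gt_d2
  have hpi' := Real.pi_lt_d2
  have h1 : 1 ≤ 2 ^ ⌈Real.logb 2 (1 / ε)⌉₊ * ε :=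
    (div_le_iff₀ hε).1 (le_two_pow_ceil_logb (one_div_pos.2 hε))
  rw [two_pow_estimateQubits]
  split_ifs with hδ2
  -- Here `δ ≥ 0.18`, while `Mε ≥ 8` gives `1 / (8 - π/2) < 0.16`.
  · have h8 : 8 / Real.pi ^ 2 ≤ 0.82 := by
      rw [div_le_iff₀ (by positivity)]
      nlinarith
    refine ⟨by linarith, ?_⟩
    rw [div_le_iff₀ (by linarith)]
    nlinarith
  · have h2 : 1 ≤ 2 ^ ⌈Real.logb 2 (1 / δ)⌉₊ * δ :=
      (div_le_iff₀ hδ).1 (le_two_pow_ceil_logb (one_div_pos.2 hδ))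
    have h3 : (1 : ℝ) ≤ 2 ^ ⌈Real.logb 2 (1 / δ)⌉₊ := one_le_pow₀ one_le_two
    generalize (2 : ℝ) ^ ⌈Real.logb 2 (1 / δ)⌉₊ = q at h2 h3
    generalize (2 : ℝ) ^ ⌈Real.logb 2 (1 / ε)⌉₊ = p at h1
    -- Since `q ≥ 1` and `qδ ≥ 1`, `δ (8q - π/2) ≥ (8 - π/2) qδ ≥ 1`.
    have h4 : 8 * q ≤ 8 * p * q * ε := by nlinarith
    refine ⟨by linarith, ?_⟩
    rw [div_le_iff₀ (by linarith)]
    nlinarith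

/-! ### Eigenvectors of the Grover operator -/

open scoped ComplexOrder in
/-- A unitary `2 × 2` matrix with conjugate eigenvalues splits every vector into two orthogonal
eigenvectors. -/
theorem exists_orthogonal_eigenvectors {G : Matrix (Fin 2) (Fin 2) ℂ} {l μ : ℂ}
    (hG : Gᴴ * G = 1) (htr : Gᴴ = (l + μ) • (1 : Matrix (Fin 2) (Fin 2) ℂ) - G)
    (hlμ : l * μ = 1) (hconj : star μ = l) (v : Fin 2 → ℂ) :
    ∃ ψ₀ ψ₁ : Fin 2 → ℂ, v = ψ₀ + ψ₁ ∧ star ψ₀ ⬝ᵥ ψ₁ = 0 ∧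
      G.mulVec ψ₀ = l • ψ₀ ∧ G.mulVec ψ₁ = μ • ψ₁ := by
  -- The Cayley–Hamilton relation, obtained by multiplying `htr` by `G`.
  have hsq : G * G = (l + μ) • G - 1 := by
    have := hG
    rw [htr, sub_mul, smul_mul_assoc, one_mul] at this
    rw [← this]
    abel
  -- The ranges of `G - μ` and `G - l` are orthogonal; by `hev` they consist of eigenvectors for `l`
  -- and `μ`.
  have hN : (G - μ • 1)ᴴ * (G - l • 1) = 0 := by
    rw [Matrix.conjTranspose_sub, Matrix.conjTranspose_smul, hconj, Matrix.conjTranspose_one,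
      sub_mul, mul_sub, mul_sub, hG, htr]
    simp only [smul_mul_assoc, mul_smul_comm, one_mul, mul_one]
    have h : (1 : Matrix (Fin 2) (Fin 2) ℂ) - l • ((l + μ) • 1 - G) - (l • G - l • l • 1) =
      (1 - l * μ) • 1 := by module
    rw [h, hlμ, sub_self, zero_smul]
  have hev : ∀ a b : ℂ, a + b = l + μ → a * b = 1 →
      G * (G - b • 1) = a • (G - b • 1) := by
    intro a b hab h1
    rw [mul_sub, hsq, mul_smul_comm, mul_one, smul_sub, smul_smul, h1, ← hab]
    module
  -- If the eigenvalues coincide, `hN` reads `Nᴴ N = 0`, so `G` is scalar and one summand is zero.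
  -- Otherwise `v = ((G - μ) v - (G - l) v) / (l - μ)`.
  by_cases hne : l = μ
  · subst hne
    rw [Matrix.conjTranspose_mul_self_eq_zero, sub_eq_zero] at hN
    refine ⟨v, 0, by simp, by simp, ?_, by simp⟩
    rw [hN, Matrix.smul_mulVec, Matrix.one_mulVec]
  · have hd : l - μ ≠ 0 := sub_ne_zero.2 hne
    refine ⟨(l - μ)⁻¹ • (G - μ • 1).mulVec v, -((l - μ)⁻¹ • (G - l • 1).mulVec v), ?_, ?_, ?_, ?_⟩
    · rw [← sub_eq_add_neg, ← smul_sub, ← Matrix.sub_mulVec]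
      rw [show G - μ • 1 - (G - l • 1) = (l - μ) • (1 : Matrix (Fin 2) (Fin 2) ℂ) by module]
      rw [Matrix.smul_mulVec, Matrix.one_mulVec, smul_smul, inv_mul_cancel₀ hd, one_smul]
    · rw [dotProduct_neg, star_smul, smul_dotProduct, dotProduct_smul, Matrix.star_mulVec,
        ← Matrix.dotProduct_mulVec, Matrix.mulVec_mulVec, hN]
      simp
    · rw [Matrix.mulVec_smul, Matrix.mulVec_mulVec, hev l μ rfl hlμ, Matrix.smul_mulVec, smul_comm]
    · rw [Matrix.mulVec_neg, Matrix.mulVec_smul, Matrix.mulVec_mulVec,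
        hev μ l (add_comm _ _) (by rw [mul_comm, hlμ]), Matrix.smul_mulVec, smul_neg, smul_comm]

theorem flipZero_mul_self : flipZero * flipZero = 1 := by
  ext i j
  fin_cases i <;> fin_cases j <;> simp [flipZero]

/-- Conjugating `S₀` by `A` gives the reflection along `A|0⟩`, so `G` depends on `A` only through
that state. -/
theorem grover_eq (A : Matrix.unitaryGroup (Fin 2) ℂ) :
    grover A = -((1 - (2 : ℂ) • Matrix.vecMulVec (prepared A) (star (prepared A))) * flipZero) := by
  have hA : (A : Matrix (Fin 2) (Fin 2) ℂ) * (A : Matrix (Fin 2) (Fin 2) ℂ)ᴴ = 1 :=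
    Matrix.mem_unitaryGroup_iff.1 A.2
  rw [grover, ← hA]
  congr 2
  ext i j
  simp [Matrix.mul_apply, flipZero, Fin.sum_univ_two, prepared, Matrix.vecMulVec_apply,
    Matrix.diagonal]
  ring

/-- For a unitary `2 × 2` matrix of determinant 1, `G + G⁻¹` is the trace times the identity.
Normalization of the state enters through the diagonal entries. -/
theorem grover_conjTranspose (A : Matrix.unitaryGroup (Fin 2) ℂ)
    (hn : ∑ b, ‖prepared A b‖ ^ 2 = 1) :
    (grover A)ᴴ = ((2 - 4 * ‖prepared A 0‖ ^ 2 : ℝ) : ℂ) • (1 : Matrix (Fin 2) (Fin 2) ℂ) -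
      grover A := by
  have hc : (starRingEnd ℂ) (prepared A 0) * prepared A 0 +
      (starRingEnd ℂ) (prepared A 1) * prepared A 1 = 1 := by
    rw [Fin.sum_univ_two] at hn
    rw [Complex.conj_mul', Complex.conj_mul']
    exact_mod_cast hn
  have h0 : ((‖prepared A 0‖ : ℝ) : ℂ) ^ 2 = (starRingEnd ℂ) (prepared A 0) * prepared A 0 :=
    (Complex.conj_mul' _).symm
  rw [grover_eq]
  ext i j
  fin_cases i <;> fin_cases j <;>
    simp [Matrix.mul_apply, flipZero, Matrix.vecMulVec_apply, Matrix.diagonal, h0,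
      Matrix.one_apply] <;>
    first | ring1 | linear_combination 4 * hc

theorem grover_unitary (A : Matrix.unitaryGroup (Fin 2) ℂ) : (grover A)ᴴ * grover A = 1 := by
  have hA : (A : Matrix (Fin 2) (Fin 2) ℂ)ᴴ * (A : Matrix (Fin 2) (Fin 2) ℂ) = 1 :=
    Matrix.mem_unitaryGroup_iff'.1 A.2
  have hA' : (A : Matrix (Fin 2) (Fin 2) ℂ) * (A : Matrix (Fin 2) (Fin 2) ℂ)ᴴ = 1 :=
    Matrix.mem_unitaryGroup_iff.1 A.2
  have hc : ∀ X Y Z : Matrix (Fin 2) (Fin 2) ℂ, X * Y = 1 → X * (Y * Z) = Z := fun X Y Z h => by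
    rw [← mul_assoc, h, one_mul]
  simp only [grover, Matrix.conjTranspose_neg, Matrix.conjTranspose_mul, conjTranspose_flipZero,
    Matrix.conjTranspose_conjTranspose, neg_mul_neg, mul_assoc]
  rw [hc _ _ _ hA, hc _ _ _ flipZero_mul_self, hc _ _ _ hA', flipZero_mul_self]

/-- Pythagoras: without cross terms, outcome probabilities are averages over the two eigenvectors.
-/
theorem sum_norm_sq_add {ψ₀ ψ₁ : Fin 2 → ℂ} (h : star ψ₀ ⬝ᵥ ψ₁ = 0) (c d : ℂ) :
    ∑ b, ‖ψ₀ b * c + ψ₁ b * d‖ ^ 2 =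
      (∑ b, ‖ψ₀ b‖ ^ 2) * ‖c‖ ^ 2 + (∑ b, ‖ψ₁ b‖ ^ 2) * ‖d‖ ^ 2 := by
  have h1 : (starRingEnd ℂ) (ψ₀ 0) * ψ₁ 0 + (starRingEnd ℂ) (ψ₀ 1) * ψ₁ 1 = 0 := by
    simpa [dotProduct, Fin.sum_univ_two] using h
  have h2 : ψ₀ 0 * (starRingEnd ℂ) (ψ₁ 0) + ψ₀ 1 * (starRingEnd ℂ) (ψ₁ 1) = 0 := by
    simpa using congrArg (starRingEnd ℂ) h1
  simp only [Fin.sum_univ_two]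
  apply Complex.ofReal_injective
  push_cast
  simp only [← Complex.conj_mul', map_add, map_mul]
  linear_combination (starRingEnd ℂ) c * d * h1 + c * (starRingEnd ℂ) d * h2

theorem pow_mulVec_eigenvector {G : Matrix (Fin 2) (Fin 2) ℂ} {ψ : Fin 2 → ℂ} {l : ℂ}
    (h : G.mulVec ψ = l • ψ) (x : ℕ) : (G ^ x).mulVec ψ = l ^ x • ψ := by
  induction x with
  | zero => simp
  | succ x ih =>
    rw [pow_succ, ← Matrix.mulVec_mulVec, h, Matrix.mulVec_smul, ih, smul_smul, pow_succ, mul_comm]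

/-- The state prepared by `A` splits into two orthogonal eigenvectors of the Grover operator, and
amplitude estimation acts on each of them by attaching the state of an estimate register. -/
theorem estimated_decomposition (A : Matrix.unitaryGroup (Fin 2) ℂ) :
    ∃ (ψ : Fin 2 → Fin 2 → ℂ) (φ : Fin 2 → ℝ),
      prepared A = ψ 0 + ψ 1 ∧ star (ψ 0) ⬝ᵥ ψ 1 = 0 ∧
      (∀ m b j, estimated m A (b, j) =
        ψ 0 b * phaseState m (φ 0) j + ψ 1 b * phaseState m (φ 1) j) ∧
      ∀ s, Real.sin (φ s) ^ 2 = ‖prepared A 0‖ ^ 2 := by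
  have hn := sum_norm_sq_prepared A
  have hle : ‖prepared A 0‖ ≤ 1 := by
    rw [Fin.sum_univ_two] at hn
    nlinarith [sq_nonneg ‖prepared A 1‖, norm_nonneg (prepared A 0)]
  set θ := Real.arcsin ‖prepared A 0‖ with hθ
  have hsin : Real.sin θ = ‖prepared A 0‖ :=
    Real.sin_arcsin (by linarith [norm_nonneg (prepared A 0)]) hle
  set l := Complex.exp (2 * θ * Complex.I) with hl
  set μ := Complex.exp (2 * (-θ : ℝ) * Complex.I) with hμ
  have hlμ : l * μ = 1 := by
    rw [hl, hμ, ← Complex.exp_add]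
    simp
  have hconj : star μ = l := by
    rw [hl, hμ, ← starRingEnd_apply, ← Complex.exp_conj]
    simp [Complex.conj_ofNat]
  have htr : ((2 - 4 * ‖prepared A 0‖ ^ 2 : ℝ) : ℂ) = l + μ := by
    have h1 : l + μ = 2 * Complex.cos (2 * θ) := by
      rw [Complex.two_cos, hl, hμ]
      simp
    rw [h1, ← hsin, Complex.cos_two_mul, Complex.cos_sq']
    push_cast
    ring
  obtain ⟨ψ₀, ψ₁, hsum, horth, h0, h1⟩ := exists_orthogonal_eigenvectors (grover_unitary A)
    (htr ▸ grover_conjTranspose A hn) hlμ hconj (prepared A)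
  refine ⟨![ψ₀, ψ₁], ![θ, -θ], hsum, horth, fun m b j => ?_, fun s => ?_⟩
  · rw [estimated_apply]
    simp only [phaseState, Matrix.cons_val_zero, Matrix.cons_val_one, Finset.mul_sum,
      ← Finset.sum_add_distrib]
    refine Finset.sum_congr rfl fun x _ => ?_
    rw [hsum, Matrix.mulVec_add, pow_mulVec_eigenvector h0, pow_mulVec_eigenvector h1]
    simp only [Pi.add_apply, Pi.smul_apply, smul_eq_mul, ← hl, ← hμ]
    ring
  · fin_cases s <;> simp [hsin]

end SimulAE

theorem mainTheorem2 :
    ∃ C : ℝ, 0 < C ∧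
      ∀ (n k : ℕ) (O : Matrix.unitaryGroup (Fin 2) ℂ)
        (U : ℕ → Fin (2 ^ n) → Matrix.unitaryGroup (Fin 2) ℂ)
        (V : Matrix.unitaryGroup (Fin (2 ^ n)) ℂ)
        (α : Fin (2 ^ n) → ℂ) (ξ : Fin (2 ^ n) → Fin 2 → ℂ) (ε δ : ℝ) (m : ℕ),
        0 < ε → ε ≤ 1 → 0 < δ → δ < 1 →
        -- `A_initial |0^n⟩ = ∑ y, α y |y⟩` and `A_y |0⟩ = |ξ_y⟩ = ξ y 0 |0⟩ + ξ y 1 |1⟩`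
        (∀ y, SimulAE.prepared V y = α y) →
        (∀ y, SimulAE.prepared (SimulAE.algo O U y k) = ξ y) →
        m = SimulAE.estimateQubits ε δ →
        -- the number of queries
        ((SimulAE.Circuit.queries (SimulAE.simulAE m V U k) : ℕ) : ℝ) ≤ C * k / (ε * δ) ∧
        -- the output state
        (∀ y b j, SimulAE.Circuit.run O (SimulAE.simulAE m V U k) (Pi.single (0, 0, 0) 1) (y, b, j)
          = α y * SimulAE.estimated m (SimulAE.algo O U y k) (b, j)) ∧
        -- its form, for every index
        (∀ y, ∃ (ψ : Fin 2 → Fin 2 → ℂ) (e : Fin 2 → Fin (2 ^ m) → ℂ),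
          ξ y = ψ 0 + ψ 1 ∧
          ∑ b, star (ψ 0 b) * ψ 1 b = 0 ∧
          (∀ b j, SimulAE.estimated m (SimulAE.algo O U y k) (b, j) =
            ψ 0 b * e 0 j + ψ 1 b * e 1 j) ∧
          ∀ s, ∑ j, ‖e s j‖ ^ 2 = 1 ∧
            1 - δ ≤ ∑ j ∈ SimulAE.goodOutcomes m (‖ξ y 0‖ ^ 2) ε, ‖e s j‖ ^ 2) ∧
        -- given that the index is `y`, the outcome of the last register is an `ε`-estimate
        (∀ y, 1 - δ ≤ ∑ b, ∑ j ∈ SimulAE.goodOutcomes m (‖ξ y 0‖ ^ 2) ε,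
          ‖SimulAE.estimated m (SimulAE.algo O U y k) (b, j)‖ ^ 2) ∧
        -- measuring the output yields an index together with an `ε`-estimate for it
        1 - δ ≤ ∑ y, ∑ b, ∑ j ∈ SimulAE.goodOutcomes m (‖ξ y 0‖ ^ 2) ε,
          ‖SimulAE.Circuit.run O (SimulAE.simulAE m V U k) (Pi.single (0, 0, 0) 1) (y, b, j)‖ ^ 2
    := by
  -- The count is at most `2 ^ m * 2k`, and `2 ^ m ≤ 32 / (ε * δ)`.
  refine ⟨64, by norm_num, ?_⟩
  intro n k O U V α ξ ε δ m hε hε1 hδ hδ1 hα hξ hm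
  have hrun : ∀ y b j, SimulAE.Circuit.run O (SimulAE.simulAE m V U k) (Pi.single (0, 0, 0) 1)
      (y, b, j) = α y * SimulAE.estimated m (SimulAE.algo O U y k) (b, j) := fun y b j => by
    rw [SimulAE.run_simulAE, hα]
  have hform : ∀ y, ∃ (ψ : Fin 2 → Fin 2 → ℂ) (e : Fin 2 → Fin (2 ^ m) → ℂ),
      ξ y = ψ 0 + ψ 1 ∧
      ∑ b, star (ψ 0 b) * ψ 1 b = 0 ∧
      (∀ b j, SimulAE.estimated m (SimulAE.algo O U y k) (b, j) =
        ψ 0 b * e 0 j + ψ 1 b * e 1 j) ∧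
      ∀ s, ∑ j, ‖e s j‖ ^ 2 = 1 ∧
        1 - δ ≤ ∑ j ∈ SimulAE.goodOutcomes m (‖ξ y 0‖ ^ 2) ε, ‖e s j‖ ^ 2 := by
    intro y
    obtain ⟨ψ, φ, hsum, horth, hest, hsin⟩ :=
      SimulAE.estimated_decomposition (SimulAE.algo O U y k)
    obtain ⟨hbig, herr⟩ := SimulAE.estimateQubits_spec hε hδ
    have hm1 : 1 ≤ m := by rw [hm, SimulAE.estimateQubits]; omega
    rw [← hm] at hbig herr
    refine ⟨ψ, fun s => SimulAE.phaseState m (φ s), hξ y ▸ hsum, horth, hest m, fun s =>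
      ⟨SimulAE.sum_norm_sq_phaseState m _, ?_⟩⟩
    rw [← hξ y, ← hsin s]
    exact SimulAE.phaseState_good m (φ s) ε δ hε1 hm1 hbig herr
  have hgood : ∀ y, 1 - δ ≤ ∑ b, ∑ j ∈ SimulAE.goodOutcomes m (‖ξ y 0‖ ^ 2) ε,
      ‖SimulAE.estimated m (SimulAE.algo O U y k) (b, j)‖ ^ 2 := by
    intro y
    obtain ⟨ψ, e, hsum, horth, hest, he⟩ := hform y
    have hnorm : ∑ b, ‖ψ 0 b‖ ^ 2 + ∑ b, ‖ψ 1 b‖ ^ 2 = 1 := by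
      have h1 := SimulAE.sum_norm_sq_prepared (SimulAE.algo O U y k)
      have h2 := SimulAE.sum_norm_sq_add horth 1 1
      rw [hξ, hsum] at h1
      simp only [mul_one, norm_one, one_pow] at h2
      exact h2.symm.trans h1
    -- The success probability is the mean of those of `e 0` and `e 1`, with weights `‖ψ 0‖²` and
    -- `‖ψ 1‖²` that sum to 1.
    rw [Finset.sum_comm]
    simp only [hest, SimulAE.sum_norm_sq_add horth, Finset.sum_add_distrib, ← Finset.mul_sum]
    have hp0 : 0 ≤ ∑ b, ‖ψ 0 b‖ ^ 2 := Finset.sum_nonneg fun _ _ => sq_nonneg _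
    have hp1 : 0 ≤ ∑ b, ‖ψ 1 b‖ ^ 2 := Finset.sum_nonneg fun _ _ => sq_nonneg _
    calc 1 - δ = (∑ b, ‖ψ 0 b‖ ^ 2) * (1 - δ) + (∑ b, ‖ψ 1 b‖ ^ 2) * (1 - δ) := by
          rw [← add_mul, hnorm, one_mul]
      _ ≤ _ := add_le_add (mul_le_mul_of_nonneg_left (he 0).2 hp0)
          (mul_le_mul_of_nonneg_left (he 1).2 hp1)
  refine ⟨?_, hrun, hform, hgood, ?_⟩
  · have h2m := SimulAE.two_pow_estimateQubits_le hε hε1 hδ hδ1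
    rw [← hm] at h2m
    rw [SimulAE.queries_simulAE]
    push_cast [Nat.cast_sub (Nat.one_le_two_pow (n := m))]
    have hk : (0 : ℝ) ≤ k := k.cast_nonneg
    calc (k : ℝ) + (2 ^ m - 1) * (2 * k) ≤ 2 ^ m * (2 * k) := by linarith
      _ ≤ 32 / (ε * δ) * (2 * k) := by gcongr
      _ = 64 * k / (ε * δ) := by ring
  · simp only [hrun, norm_mul, mul_pow, ← Finset.mul_sum]
    calc 1 - δ = ∑ y, ‖α y‖ ^ 2 * (1 - δ) := by
          have := SimulAE.sum_norm_sq_prepared V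
          simp only [hα] at this
          rw [← Finset.sum_mul, this, one_mul]
      _ ≤ _ := Finset.sum_le_sum fun y _ => mul_le_mul_of_nonneg_left (hgood y) (sq_nonneg _)
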